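/- Consider a wireless powered link in which a transmitter with a fluid antenna of $M\ge 1$ ports harvests energy from a power beacon and uses it to send data to a receiver. For the two hops $i\in\{1,2\}$ and ports $m\in\{1,\dots,M\}$ the channel coefficients are $$h_{i,m}=\sqrt{\mu}\,h_{i,0}+\sqrt{1-\mu}\,e_{i,m},$$ where $0\le\mu<1$ is the correlation factor, $h_{i,0}$ and $e_{i,m}$ have the circularly symmetric complex Gaussian law $\mathcal{CN}(0,\psi_i)$ with $\psi_i>0$, and all of them are mutually independent. Let $P_S>0$ be the transmit power of the beacon, $\sigma^2>0$ the noise power, $\rho>0$ the energy conversion efficiency, $\theta>0$ the ratio of the durations of the two hops, $R>0$ the data rate, and $\Gamma_{\rm th}=2^R-1$. With the best port selected, the received SNR is $$\Gamma_{m^*}=\frac{P_S\rho\theta}{\sigma^2}\max_{1\le m\le M}|h_{1,m}|^2|h_{2,m}|^2,$$ and the outage probability is $P_{\rm out}=\Pr(\Gamma_{m^*}\le\Gamma_{\rm th})=\Pr\big(\max_{m}|h_{1,m}|^2|h_{2,m}|^2\le z\big)$ with $z=\frac{\Gamma_{\rm th}\sigma^2}{P_S\rho\theta}$. Put $$\chi=\Big(\frac{1-\mu}{M\mu+1-\mu}\Big)^2,\qquad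 \beta=\frac{\Gamma_{\rm th}\sigma^2}{P_S\rho\theta\,\psi_1\psi_2(1-\mu)^2}.$$ Then, for fixed $M,\mu,\psi_1,\psi_2$: (1) $P_{\rm out}\sim\chi\,(-\beta\ln\beta)^M$, that is, the quotient of the two sides tends to $1$, whenever the positive parameters $P_S,\sigma^2,\rho,\theta,R$ vary in such a way that $z\to0$ (in particular when $P_S/\sigma^2\to\infty$ with $\rho,\theta,R$ fixed). (2) The diversity order is $M$: for fixed $\rho,\theta,R$, $$\lim_{P_S/\sigma^2\to\infty}\ -\frac{\ln P_{\rm out}}{\ln(P_S/\sigma^2)}=M.$$ -/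

import Mathlib

open MeasureTheory ProbabilityTheory Filter Topology Asymptotics

namespace FAS

/-- The circularly symmetric complex Gaussian distribution `CN(0, ψ)`: the real and the imaginary
part are independent real Gaussians of mean `0` and variance `ψ / 2`. -/
noncomputable def complexGaussian (ψ : ℝ) : Measure ℂ :=
  ((gaussianReal 0 (ψ / 2).toNNReal).prod (gaussianReal 0 (ψ / 2).toNNReal)).map
    (fun q : ℝ × ℝ => (⟨q.1, q.2⟩ : ℂ))

/-- The random inputs of the correlated Rayleigh channel model with `M` ports. The index `0 : Fin 2`
is the hop from the power beacon to the transmitter, `1 : Fin 2` the hop from the transmitter to the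
receiver. `h₀ i` is the virtual reference channel of hop `i` and `e i m` the innovation of
port `m` in hop `i`; they are distributed as `CN(0, ψ i)` and all of them are mutually
independent. -/
structure IsRayleighInput {Ω : Type*} [MeasurableSpace Ω] (P : Measure Ω) {M : ℕ}
    (ψ : Fin 2 → ℝ) (h₀ : Fin 2 → Ω → ℂ) (e : Fin 2 → Fin M → Ω → ℂ) : Prop where
  law_ref : ∀ i, HasLaw (h₀ i) (complexGaussian (ψ i)) P
  law_port : ∀ i m, HasLaw (e i m) (complexGaussian (ψ i)) P
  indep : iIndepFun (fun j : Fin 2 × Option (Fin M) => j.2.elim (h₀ j.1) (e j.1)) P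

variable {Ω : Type*} {M : ℕ}

/-- The channel coefficient `h_{i,m} = √μ h_{i,0} + √(1-μ) e_{i,m}` of hop `i` and port `m`. -/
noncomputable def channel (μ : ℝ) (h₀ : Fin 2 → Ω → ℂ) (e : Fin 2 → Fin M → Ω → ℂ)
    (i : Fin 2) (m : Fin M) (ω : Ω) : ℂ :=
  (Real.sqrt μ : ℂ) * h₀ i ω + (Real.sqrt (1 - μ) : ℂ) * e i m ω

/-- The received SNR when port `m` is used in both hops, for channel coefficients `h`, transmit
power `PS`, conversion efficiency `ρ`, duration ratio `θ` and noise power `σ2` (that is, `σ²`). -/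
noncomputable def portSNR (h : Fin 2 → Fin M → Ω → ℂ) (PS ρ θ σ2 : ℝ) (m : Fin M) (ω : Ω) : ℝ :=
  PS * ρ * θ / σ2 * (‖h 0 m ω‖ ^ 2 * ‖h 1 m ω‖ ^ 2)

/-- The received SNR when the best port is selected. -/
noncomputable def bestPortSNR (h : Fin 2 → Fin M → Ω → ℂ) (PS ρ θ σ2 : ℝ) (ω : Ω) : ℝ :=
  ⨆ m : Fin M, portSNR h PS ρ θ σ2 m ω

/-- The SNR threshold `2 ^ R - 1` that belongs to the data rate `R`. -/
noncomputable def snrThreshold (R : ℝ) : ℝ := (2 : ℝ) ^ R - 1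

/-- The probability that the SNR of the best port does not exceed the threshold. -/
noncomputable def outageProb [MeasurableSpace Ω] (P : Measure Ω) (h : Fin 2 → Fin M → Ω → ℂ)
    (PS ρ θ σ2 R : ℝ) : ℝ :=
  P.real {ω | bestPortSNR h PS ρ θ σ2 ω ≤ snrThreshold R}

/-- The normalized threshold `z = Γ_th σ² / (P_S ρ θ)`. -/
noncomputable def zParam (PS ρ θ σ2 R : ℝ) : ℝ := snrThreshold R * σ2 / (PS * ρ * θ)

/-- `β = Γ_th σ² / (P_S ρ θ ψ₁ ψ₂ (1-μ)²)`. -/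
noncomputable def betaParam (ψ : Fin 2 → ℝ) (μ PS ρ θ σ2 R : ℝ) : ℝ :=
  snrThreshold R * σ2 / (PS * ρ * θ * ψ 0 * ψ 1 * (1 - μ) ^ 2)

/-- `χ = ((1-μ) / (M μ + 1 - μ))²`. -/
noncomputable def chiParam (M : ℕ) (μ : ℝ) : ℝ := ((1 - μ) / (M * μ + 1 - μ)) ^ 2

end FAS

/-!
Write `z` for the normalized threshold. The proof rests on conditioning on the two reference
channels `a`, `b`: given these, the ports are independent and identically distributed, so the outage
probability is the average over `(a, b)` of the `M`-th power of the conditional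
outage probability of one port (`FAS.measureReal_forall_le_eq_integral`).

Given `(a, b)`, the two power gains of a port are independent, and each is the squared modulus of a
complex Gaussian of mean `√μ a` (or `√μ b`) and variance `v = (1-μ) ψᵢ`. Polar coordinates give it a
continuous density on `(0, ∞)`, bounded by `1/v` whatever the mean, with value
`exp (-μ |a|² / v) / v` at `0` (`FAS.hasBoundedDensity_sq_add_sq`, `FAS.sqDensity_zero`).

For independent positive variables `X`, `Y` with bounded continuous densities `g₁`, `g₂`, one has
`P (X Y ≤ z) ∼ g₁(0) g₂(0) z log (1/z)` (`FAS.tendsto_measureReal_mul_le_div`). Indeed the parts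
`X ≤ z` and `Y ≤ z` have probability `O(z)`; on the rest of the event `Y` lies in `(z, 1]`, and the substitution
`Y = z ^ u` turns the probability into `z log (1/z)` times an integral over `u ∈ [0, 1]` whose
integrand tends boundedly to `g₁(0) g₂(0)`. All errors are controlled by the bounds of the densities
only, hence uniformly in `(a, b)`.

Dominated convergence over `(a, b)` therefore shows that the outage probability divided by
`(z log (1/z)) ^ M` tends to the mean of `(g₁(0) g₂(0)) ^ M`
(`FAS.tendsto_integral_portOutage_div`). As `|a|²` and `|b|²` are exponentially distributed, that
mean is `χ / (ψ₁ ψ₂ (1-μ)²) ^ M`. Since `β` is a constant multiple of `z`, and `log β ∼ log z`, this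
is the asymptotic formula; its logarithm gives the diversity order.
-/

namespace FAS

/-! ### The lower tail of a product of two independent variables -/

/-- `ν` is concentrated on `(0, ∞)` and has there a continuous density `g` with values in `[0, K]`.
Only the values of `g` on `[0, ∞)` matter; continuity on all of `ℝ` is a convenience. -/
structure HasBoundedDensity (ν : Measure ℝ) (g : ℝ → ℝ) (K : ℝ) : Prop where
  eq_withDensity : ν = (volume.restrict (Set.Ioi 0)).withDensity (fun t => ENNReal.ofReal (g t))
  continuous : Continuous g
  nonneg : ∀ t, 0 ≤ g t
  le : ∀ t, g t ≤ K

/-- The average of `g` over the interval from `0` to `x`, written so that the value at `x = 0`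
is `g 0`. -/
noncomputable def avg (g : ℝ → ℝ) (x : ℝ) : ℝ := ∫ s in (0 : ℝ)..1, g (s * x)

lemma avg_zero (g : ℝ → ℝ) : avg g 0 = g 0 := by simp [avg]

lemma continuous_avg {g : ℝ → ℝ} (hg : Continuous g) : Continuous (avg g) :=
  intervalIntegral.continuous_parametric_intervalIntegral_of_continuous' (by fun_prop) _ _

lemma mul_avg (g : ℝ → ℝ) (x : ℝ) : x * avg g x = ∫ t in (0 : ℝ)..x, g t := by
  simp [avg, intervalIntegral.mul_integral_comp_mul_right]

section Density

variable {ν ν₁ ν₂ : Measure ℝ} {g g₁ g₂ : ℝ → ℝ} {K K₁ K₂ : ℝ}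

lemma HasBoundedDensity.avg_nonneg (h : HasBoundedDensity ν g K) (x : ℝ) : 0 ≤ avg g x :=
  intervalIntegral.integral_nonneg zero_le_one fun _ _ => h.nonneg _

lemma HasBoundedDensity.bound_nonneg (h : HasBoundedDensity ν g K) : 0 ≤ K :=
  (h.nonneg 0).trans (h.le 0)

lemma HasBoundedDensity.avg_le (h : HasBoundedDensity ν g K) (x : ℝ) : avg g x ≤ K := by
  have := intervalIntegral.integral_mono_on (μ := volume) (f := fun s => g (s * x))
    (g := fun _ => K) zero_le_one
    ((h.continuous.comp (by fun_prop : Continuous fun s : ℝ => s * x)).intervalIntegrable _ _)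
    (by simp) (fun s _ => h.le _)
  simpa [avg] using this

lemma HasBoundedDensity.measure_Iic (h : HasBoundedDensity ν g K) {x : ℝ} (hx : 0 ≤ x) :
    ν (Set.Iic x) = ENNReal.ofReal (x * avg g x) := by
  rw [h.eq_withDensity, withDensity_apply _ measurableSet_Iic, Measure.restrict_restrict
    measurableSet_Iic, Set.inter_comm, Set.Ioi_inter_Iic, mul_avg,
    intervalIntegral.integral_of_le hx, ofReal_integral_eq_lintegral_ofReal]
  · exact (h.continuous.integrableOn_Icc).mono_set Set.Ioc_subset_Icc_self
  · exact ae_of_all _ h.nonneg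

lemma HasBoundedDensity.measureReal_Iic_le (h : HasBoundedDensity ν g K) {x : ℝ} (hx : 0 ≤ x) :
    ν.real (Set.Iic x) ≤ K * x := by
  rw [Measure.real, h.measure_Iic hx, ENNReal.toReal_ofReal (mul_nonneg hx (h.avg_nonneg x)),
    mul_comm]
  exact mul_le_mul_of_nonneg_right (h.avg_le x) hx

/-- The main term of the probability that the product of two independent variables of densities
`g₁` and `g₂` is at most `z = exp (-L)`, divided by `z * L`. The second factor is written
`exp (-L u)`, so that `u` is its size on the logarithmic scale between `1` and `z`. -/
noncomputable def mainTerm (g₁ g₂ : ℝ → ℝ) (L : ℝ) : ℝ :=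
  ∫ u in (0 : ℝ)..1, avg g₁ (Real.exp (-(L * (1 - u)))) * g₂ (Real.exp (-(L * u)))

lemma mainTerm_le (h₁ : HasBoundedDensity ν₁ g₁ K₁) (h₂ : HasBoundedDensity ν₂ g₂ K₂) (L : ℝ) :
    mainTerm g₁ g₂ L ≤ K₁ * K₂ := by
  have hc := continuous_avg h₁.continuous
  have hc₂ := h₂.continuous
  have := intervalIntegral.integral_mono_on (μ := volume)
    (f := fun u => avg g₁ (Real.exp (-(L * (1 - u)))) * g₂ (Real.exp (-(L * u))))
    (g := fun _ => K₁ * K₂) zero_le_one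
    ((by fun_prop : Continuous _).intervalIntegrable _ _)
    (by simp) (fun s _ => mul_le_mul (h₁.avg_le _) (h₂.le _) (h₂.nonneg _) h₁.bound_nonneg)
  simpa [mainTerm] using this

lemma tendsto_mainTerm (h₁ : HasBoundedDensity ν₁ g₁ K₁) (h₂ : HasBoundedDensity ν₂ g₂ K₂) :
    Tendsto (mainTerm g₁ g₂) atTop (𝓝 (g₁ 0 * g₂ 0)) := by
  have hc := continuous_avg h₁.continuous
  have hc₂ := h₂.continuous
  have key : Tendsto (mainTerm g₁ g₂) atTop (𝓝 (∫ _u in (0 : ℝ)..1, g₁ 0 * g₂ 0)) := by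
    refine intervalIntegral.tendsto_integral_filter_of_dominated_convergence
      (fun _ => K₁ * K₂) ?_ ?_ (by simp) ?_
    · exact Eventually.of_forall fun L => (by fun_prop : Continuous _).aestronglyMeasurable
    · refine Eventually.of_forall fun L => ae_of_all _ fun u _ => ?_
      rw [Real.norm_of_nonneg (mul_nonneg (h₁.avg_nonneg _) (h₂.nonneg _))]
      exact mul_le_mul (h₁.avg_le _) (h₂.le _) (h₂.nonneg _) h₁.bound_nonneg
    -- for `0 < u < 1` both arguments tend to `0`
    · have h1 : ∀ᵐ u : ℝ, u ≠ 1 := by simp [ae_iff]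
      filter_upwards [h1] with u hu1 hu
      rw [Set.uIoc_of_le zero_le_one] at hu
      have hexp : ∀ c : ℝ, 0 < c → Tendsto (fun L : ℝ => Real.exp (-(L * c))) atTop (𝓝 0) :=
        fun c hc => Real.tendsto_exp_neg_atTop_nhds_zero.comp (tendsto_id.atTop_mul_const hc)
      have a := (hc.tendsto 0).comp (hexp (1 - u) (sub_pos.2 (lt_of_le_of_ne hu.2 hu1)))
      have b := (hc₂.tendsto 0).comp (hexp u hu.1)
      rw [avg_zero] at a
      exact a.mul b
  simpa using key

/-- The substitution `y = z ^ u` in the main term. -/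
lemma integral_eq_mainTerm (hg₁ : Continuous g₁) (hg₂ : Continuous g₂) {z : ℝ} (hz : 0 < z) :
    ∫ y in z..1, z / y * avg g₁ (z / y) * g₂ y =
      z * -Real.log z * mainTerm g₁ g₂ (-Real.log z) := by
  set L := -Real.log z with hL
  have hc := continuous_avg hg₁
  have hzL : z = Real.exp (-L) := by rw [hL, neg_neg, Real.exp_log hz]
  have hsub := intervalIntegral.integral_comp_mul_deriv'' (a := 1) (b := 0)
    (f := fun u => Real.exp (-(L * u))) (f' := fun u => Real.exp (-(L * u)) * -L)
    (g := fun y => z / y * avg g₁ (z / y) * g₂ y)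
    (by fun_prop)
    (fun u _ => by
      have : HasDerivAt (fun u : ℝ => -(L * u)) (-L) u :=
        (((hasDerivAt_id u).const_mul L).neg).congr_deriv (by simp)
      exact this.exp.hasDerivWithinAt)
    (by fun_prop)
    (by
      have hne : ∀ y ∈ (fun u => Real.exp (-(L * u))) '' Set.uIcc 1 0, y ≠ 0 := by
        rintro _ ⟨u, -, rfl⟩
        exact (Real.exp_pos _).ne'
      have hdiv : ContinuousOn (fun y : ℝ => z / y)
          ((fun u => Real.exp (-(L * u))) '' Set.uIcc 1 0) :=
        continuousOn_const.div continuousOn_id hne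
      exact (hdiv.mul (hc.comp_continuousOn hdiv)).mul hg₂.continuousOn)
  simp only [mul_one, mul_zero, neg_zero, Real.exp_zero] at hsub
  rw [← hzL] at hsub
  rw [← hsub, intervalIntegral.integral_symm, mainTerm, ← intervalIntegral.integral_const_mul,
    ← intervalIntegral.integral_neg]
  refine intervalIntegral.integral_congr fun u _ => ?_
  have hq : z / Real.exp (-(L * u)) = Real.exp (-(L * (1 - u))) := by
    rw [hzL, ← Real.exp_sub]
    congr 1
    ring
  have hm : Real.exp (-(L * (1 - u))) * Real.exp (-(L * u)) = z := by
    rw [hzL, ← Real.exp_add]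
    congr 1
    ring
  simp only [Function.comp_apply, hq]
  rw [← hm]
  ring

/-- The part of the event `x * y ≤ z` with `y ∈ (z, 1]`, which carries the leading term. -/
lemma measureReal_strip (h₁ : HasBoundedDensity ν₁ g₁ K₁) (h₂ : HasBoundedDensity ν₂ g₂ K₂)
    [IsProbabilityMeasure ν₁] [IsProbabilityMeasure ν₂] {z : ℝ} (hz : 0 < z) (hz1 : z < 1) :
    (ν₁.prod ν₂).real {p | p.1 * p.2 ≤ z ∧ p.2 ∈ Set.Ioc z 1} =
      z * -Real.log z * mainTerm g₁ g₂ (-Real.log z) := by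
  have hc := continuous_avg h₁.continuous
  have hc₂ := h₂.continuous
  have hmeas : MeasurableSet {p : ℝ × ℝ | p.1 * p.2 ≤ z ∧ p.2 ∈ Set.Ioc z 1} := by
    measurability
  have hslice : ∀ y, ν₁ ((fun x => (x, y)) ⁻¹' {p : ℝ × ℝ | p.1 * p.2 ≤ z ∧ p.2 ∈ Set.Ioc z 1}) =
      (Set.Ioc z 1).indicator (fun y => ENNReal.ofReal (z / y * avg g₁ (z / y))) y := by
    intro y
    by_cases hy : y ∈ Set.Ioc z 1
    · have hy0 : 0 < y := hz.trans hy.1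
      rw [Set.indicator_of_mem hy, ← h₁.measure_Iic (div_pos hz hy0).le]
      congr 1
      ext x
      simp [hy.1, hy.2, le_div_iff₀ hy0]
    · rw [Set.indicator_of_notMem hy]
      convert measure_empty (μ := ν₁)
      ext x
      simpa using fun _ h => by simpa [h] using hy
  have hdc : ContinuousOn (fun y => z / y * avg g₁ (z / y) * g₂ y) (Set.Icc z 1) := by
    have hdiv : ContinuousOn (fun y : ℝ => z / y) (Set.Icc z 1) :=
      continuousOn_const.div continuousOn_id fun y hy => (hz.trans_le hy.1).ne'
    exact (hdiv.mul (hc.comp_continuousOn hdiv)).mul hc₂.continuousOn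
  have hind : Measurable ((Set.Ioc z 1).indicator
      (fun y => ENNReal.ofReal (z / y * avg g₁ (z / y)))) := by
    refine Measurable.indicator ?_ measurableSet_Ioc
    have := hc.measurable
    fun_prop
  rw [Measure.real, Measure.prod_apply_symm hmeas]
  simp_rw [hslice]
  rw [← integral_eq_mainTerm h₁.continuous hc₂ hz, h₂.eq_withDensity,
    lintegral_withDensity_eq_lintegral_mul _ (by fun_prop) hind,
    intervalIntegral.integral_of_le hz1.le, integral_eq_lintegral_of_nonneg_ae]
  · congr 1
    have hsub : Set.Ioc z 1 ⊆ Set.Ioi 0 := fun y hy => hz.trans hy.1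
    have hcomm : ((fun t => ENNReal.ofReal (g₂ t)) * (Set.Ioc z 1).indicator
        (fun y => ENNReal.ofReal (z / y * avg g₁ (z / y)))) =
        (Set.Ioc z 1).indicator (fun y => ENNReal.ofReal (z / y * avg g₁ (z / y) * g₂ y)) := by
      ext y
      by_cases hy : y ∈ Set.Ioc z 1
      · simp only [Pi.mul_apply, Set.indicator_of_mem hy]
        rw [mul_comm, ENNReal.ofReal_mul' (h₂.nonneg y)]
      · simp [Set.indicator_of_notMem hy]
    rw [hcomm, lintegral_indicator measurableSet_Ioc, Measure.restrict_restrict measurableSet_Ioc,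
      Set.inter_eq_left.2 hsub]
  · refine (ae_restrict_iff' measurableSet_Ioc).2 (ae_of_all _ fun y hy => ?_)
    exact mul_nonneg (mul_nonneg (div_pos hz (hz.trans hy.1)).le (h₁.avg_nonneg _)) (h₂.nonneg _)
  · exact (hdc.mono Set.Ioc_subset_Icc_self).aestronglyMeasurable measurableSet_Ioc

/-- The probability that the product of two independent variables with bounded densities is at
most `z`, the logarithmic main term being accurate up to `O(z)`. -/
lemma measureReal_mul_le_bounds (h₁ : HasBoundedDensity ν₁ g₁ K₁)
    (h₂ : HasBoundedDensity ν₂ g₂ K₂) [IsProbabilityMeasure ν₁] [IsProbabilityMeasure ν₂]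
    {z : ℝ} (hz : 0 < z) (hz1 : z < 1) :
    z * -Real.log z * mainTerm g₁ g₂ (-Real.log z) ≤
        (ν₁.prod ν₂).real {p | p.1 * p.2 ≤ z} ∧
      (ν₁.prod ν₂).real {p | p.1 * p.2 ≤ z} ≤
        z * -Real.log z * mainTerm g₁ g₂ (-Real.log z) + (K₁ + K₂) * z := by
  rw [← measureReal_strip h₁ h₂ hz hz1]
  refine ⟨measureReal_mono fun p hp => hp.1, ?_⟩
  -- if both factors exceed `z` and the product does not, then the second factor is at most `1`
  have hsub : {p : ℝ × ℝ | p.1 * p.2 ≤ z} ⊆ {p | p.1 * p.2 ≤ z ∧ p.2 ∈ Set.Ioc z 1} ∪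
      (Set.Iic z ×ˢ Set.univ ∪ Set.univ ×ˢ Set.Iic z) := by
    intro p hp
    by_cases h1 : p.1 ≤ z
    · exact Or.inr (Or.inl ⟨h1, trivial⟩)
    by_cases h2 : p.2 ≤ z
    · exact Or.inr (Or.inr ⟨trivial, h2⟩)
    refine Or.inl ⟨hp, not_le.1 h2, ?_⟩
    by_contra! h3
    have : p.1 * p.2 ≤ z := hp
    nlinarith
  calc _ ≤ _ := measureReal_mono hsub
    _ ≤ _ := measureReal_union_le _ _
    _ ≤ _ := add_le_add_right (measureReal_union_le _ _) _
    _ ≤ _ := by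
      rw [measureReal_prod_prod, measureReal_prod_prod, probReal_univ, probReal_univ]
      nlinarith [h₁.measureReal_Iic_le hz.le, h₂.measureReal_Iic_le hz.le]

lemma tendsto_neg_log_nhdsGT_zero : Tendsto (fun z : ℝ => -Real.log z) (𝓝[>] 0) atTop :=
  tendsto_neg_atBot_atTop.comp Real.tendsto_log_nhdsGT_zero

/-- The lower tail of a product: each factor contributes its density at `0`, and the logarithm
counts the scales at which the product can be small. -/
lemma tendsto_measureReal_mul_le_div (h₁ : HasBoundedDensity ν₁ g₁ K₁)
    (h₂ : HasBoundedDensity ν₂ g₂ K₂) [IsProbabilityMeasure ν₁] [IsProbabilityMeasure ν₂] :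
    Tendsto (fun z => (ν₁.prod ν₂).real {p | p.1 * p.2 ≤ z} / (z * -Real.log z)) (𝓝[>] 0)
      (𝓝 (g₁ 0 * g₂ 0)) := by
  have hm : Tendsto (fun z => mainTerm g₁ g₂ (-Real.log z)) (𝓝[>] 0) (𝓝 (g₁ 0 * g₂ 0)) :=
    (tendsto_mainTerm h₁ h₂).comp tendsto_neg_log_nhdsGT_zero
  have hm' : Tendsto (fun z => mainTerm g₁ g₂ (-Real.log z) + (K₁ + K₂) / -Real.log z) (𝓝[>] 0)
      (𝓝 (g₁ 0 * g₂ 0)) := by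
    simpa using hm.add (tendsto_neg_log_nhdsGT_zero.const_div_atTop (K₁ + K₂))
  have hev : ∀ᶠ z : ℝ in 𝓝[>] 0, z ∈ Set.Ioo (0 : ℝ) 1 := Ioo_mem_nhdsGT one_pos
  refine tendsto_of_tendsto_of_tendsto_of_le_of_le' hm hm' ?_ ?_
  · filter_upwards [hev] with z hz
    have hL : 0 < -Real.log z := neg_pos.2 (Real.log_neg hz.1 hz.2)
    rw [le_div_iff₀ (mul_pos hz.1 hL), mul_comm]
    exact (measureReal_mul_le_bounds h₁ h₂ hz.1 hz.2).1
  · filter_upwards [hev] with z hz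
    have hL : 0 < -Real.log z := neg_pos.2 (Real.log_neg hz.1 hz.2)
    rw [div_le_iff₀ (mul_pos hz.1 hL)]
    refine (measureReal_mul_le_bounds h₁ h₂ hz.1 hz.2).2.trans_eq ?_
    have := hL.ne'
    have h0 := neg_ne_zero.1 this
    field_simp
    ring

/-- A bound that depends on the densities only through `K₁` and `K₂`. -/
lemma measureReal_mul_le_le (h₁ : HasBoundedDensity ν₁ g₁ K₁)
    (h₂ : HasBoundedDensity ν₂ g₂ K₂) [IsProbabilityMeasure ν₁] [IsProbabilityMeasure ν₂]
    {z : ℝ} (hz : 0 < z) (hz1 : z < Real.exp (-1)) :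
    (ν₁.prod ν₂).real {p | p.1 * p.2 ≤ z} / (z * -Real.log z) ≤ K₁ * K₂ + K₁ + K₂ := by
  have hL : 1 < -Real.log z := by
    have := (Real.log_lt_iff_lt_exp hz).2 hz1
    linarith
  have hz1' : z < 1 := hz1.trans (by simp)
  rw [div_le_iff₀ (mul_pos hz (one_pos.trans hL))]
  refine (measureReal_mul_le_bounds h₁ h₂ hz hz1').2.trans ?_
  have hK := add_nonneg h₁.bound_nonneg h₂.bound_nonneg
  have e1 := mul_le_mul_of_nonneg_left (mainTerm_le h₁ h₂ (-Real.log z))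
    (mul_pos hz (one_pos.trans hL)).le
  have e2 := mul_le_mul_of_nonneg_left hL.le (mul_nonneg hK hz.le)
  linarith

end Density

/-! ### The squared modulus of a complex Gaussian -/

/-- The density on `(0, ∞)` of the squared modulus of a circularly symmetric complex Gaussian of
mean `c` and variance `v`, as the average of the planar Gaussian density over the circle of radius
`√t`. -/
noncomputable def sqDensity (c : ℂ) (v t : ℝ) : ℝ :=
  (2 * Real.pi * v)⁻¹ * ∫ θ in (-Real.pi)..Real.pi,
    Real.exp (-((√t * Real.cos θ - c.re) ^ 2 + (√t * Real.sin θ - c.im) ^ 2) / v)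

lemma continuous_sqDensity (c : ℂ) (v : ℝ) : Continuous (sqDensity c v) :=
  continuous_const.mul <|
    intervalIntegral.continuous_parametric_intervalIntegral_of_continuous' (by fun_prop) _ _

lemma sqDensity_nonneg (c : ℂ) {v : ℝ} (hv : 0 < v) (t : ℝ) : 0 ≤ sqDensity c v t :=
  mul_nonneg (by positivity) <|
    intervalIntegral.integral_nonneg (by linarith [Real.pi_pos]) fun _ _ => (Real.exp_pos _).le

lemma sqDensity_le (c : ℂ) {v : ℝ} (hv : 0 < v) (t : ℝ) : sqDensity c v t ≤ v⁻¹ := by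
  have hle : ∫ θ in (-Real.pi)..Real.pi,
      Real.exp (-((√t * Real.cos θ - c.re) ^ 2 + (√t * Real.sin θ - c.im) ^ 2) / v) ≤
      ∫ _θ in (-Real.pi)..Real.pi, (1 : ℝ) := by
    refine intervalIntegral.integral_mono_on (by linarith [Real.pi_pos])
      ((by fun_prop : Continuous _).intervalIntegrable _ _) (by simp) fun θ _ => ?_
    rw [Real.exp_le_one_iff]
    exact div_nonpos_of_nonpos_of_nonneg (neg_nonpos.2 (by positivity)) hv.le
  rw [intervalIntegral.integral_const, smul_eq_mul, mul_one] at hle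
  calc sqDensity c v t ≤ (2 * Real.pi * v)⁻¹ * (Real.pi - -Real.pi) :=
        mul_le_mul_of_nonneg_left hle (by positivity)
    _ = v⁻¹ := by
        have := Real.pi_pos.ne'
        field_simp
        ring

lemma sqDensity_zero (c : ℂ) (v : ℝ) : sqDensity c v 0 = v⁻¹ * Real.exp (-(‖c‖ ^ 2 / v)) := by
  have hn : ‖c‖ ^ 2 = c.re ^ 2 + c.im ^ 2 := by
    rw [← Complex.normSq_eq_norm_sq, Complex.normSq_apply]
    ring
  have := Real.pi_pos.ne'
  simp only [sqDensity, Real.sqrt_zero, zero_mul, zero_sub, even_two, Even.neg_pow,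
    intervalIntegral.integral_const, smul_eq_mul, hn, neg_div]
  rcases eq_or_ne v 0 with rfl | hv
  · simp
  · field_simp
    ring

lemma gaussianPDF_mul_gaussianPDF (c : ℂ) {v : ℝ} (hv : 0 < v) (x y : ℝ) :
    gaussianPDF c.re (v / 2).toNNReal x * gaussianPDF c.im (v / 2).toNNReal y =
      ENNReal.ofReal ((Real.pi * v)⁻¹ *
        Real.exp (-((x - c.re) ^ 2 + (y - c.im) ^ 2) / v)) := by
  rw [gaussianPDF, gaussianPDF, ← ENNReal.ofReal_mul (gaussianPDFReal_nonneg _ _ _)]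
  congr 1
  have hs : √(2 * Real.pi * (v / 2)) * √(2 * Real.pi * (v / 2)) = Real.pi * v := by
    rw [Real.mul_self_sqrt (by have := Real.pi_pos; positivity)]
    ring
  have he : Real.exp (-((x - c.re) ^ 2 + (y - c.im) ^ 2) / v) =
      Real.exp (-(x - c.re) ^ 2 / (2 * (v / 2))) * Real.exp (-(y - c.im) ^ 2 / (2 * (v / 2))) := by
    rw [← Real.exp_add]
    congr 1
    field_simp
    ring
  rw [gaussianPDFReal, gaussianPDFReal, Real.coe_toNNReal _ (by positivity), he, ← hs, mul_inv]
  ring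

/-- The law of the squared modulus, computed in polar coordinates. -/
lemma hasBoundedDensity_sq_add_sq (c : ℂ) {v : ℝ} (hv : 0 < v) :
    HasBoundedDensity
      (((gaussianReal c.re (v / 2).toNNReal).prod (gaussianReal c.im (v / 2).toNNReal)).map
        (fun q : ℝ × ℝ => q.1 ^ 2 + q.2 ^ 2)) (sqDensity c v) v⁻¹ where
  continuous := continuous_sqDensity c v
  nonneg := sqDensity_nonneg c hv
  le := sqDensity_le c hv
  eq_withDensity := by
    have hv0 : (v / 2).toNNReal ≠ 0 := by simpa using hv
    have hcont := continuous_sqDensity c v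
    ext s hs
    have hpre : MeasurableSet ((fun q : ℝ × ℝ => q.1 ^ 2 + q.2 ^ 2) ⁻¹' s) :=
      (by fun_prop : Measurable fun q : ℝ × ℝ => q.1 ^ 2 + q.2 ^ 2) hs
    -- the angular integral of the planar Gaussian density
    have hang : ∀ r : ℝ, 0 < r → ∫⁻ θ in Set.Ioo (-Real.pi) Real.pi,
        ENNReal.ofReal ((Real.pi * v)⁻¹ * Real.exp
          (-((r * Real.cos θ - c.re) ^ 2 + (r * Real.sin θ - c.im) ^ 2) / v)) =
        ENNReal.ofReal (2 * sqDensity c v (r ^ 2)) := by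
      intro r hr
      rw [← ofReal_integral_eq_lintegral_ofReal, integral_const_mul, sqDensity,
        Real.sqrt_sq hr.le, intervalIntegral.integral_of_le (by linarith [Real.pi_pos]),
        integral_Ioc_eq_integral_Ioo]
      · congr 1
        have := Real.pi_pos.ne'
        field_simp
      · exact ((by fun_prop : Continuous _).integrableOn_Icc).mono_set Set.Ioo_subset_Icc_self
      · exact ae_of_all _ fun θ => by positivity
    have himg : (fun r : ℝ => r ^ 2) '' Set.Ioi 0 = Set.Ioi 0 := by
      ext t
      constructor
      · rintro ⟨r, hr, rfl⟩
        exact pow_pos (Set.mem_Ioi.1 hr) 2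
      · exact fun ht => ⟨√t, Real.sqrt_pos.2 ht, Real.sq_sqrt (le_of_lt ht)⟩
    rw [Measure.map_apply (by fun_prop) hs, gaussianReal_of_var_ne_zero _ hv0,
      gaussianReal_of_var_ne_zero _ hv0, prod_withDensity (by fun_prop) (by fun_prop),
      withDensity_apply _ hpre, ← lintegral_indicator hpre, ← Measure.volume_eq_prod,
      ← lintegral_comp_polarCoord_symm, polarCoord_target, Measure.volume_eq_prod,
      setLIntegral_prod]
    · calc
        _ = ∫⁻ r in Set.Ioi (0 : ℝ), ENNReal.ofReal |2 * r| *
              s.indicator (fun t => ENNReal.ofReal (sqDensity c v t)) (r ^ 2) := by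
          refine setLIntegral_congr_fun measurableSet_Ioi fun r hr => ?_
          have hr : 0 < r := hr
          have hmem : ∀ θ : ℝ, polarCoord.symm (r, θ) ∈
              (fun q : ℝ × ℝ => q.1 ^ 2 + q.2 ^ 2) ⁻¹' s ↔ r ^ 2 ∈ s := by
            intro θ
            have : (r * Real.cos θ) ^ 2 + (r * Real.sin θ) ^ 2 = r ^ 2 := by
              rw [mul_pow, mul_pow, ← mul_add, Real.cos_sq_add_sin_sq, mul_one]
            simp [polarCoord_symm_apply, this]
          by_cases hrs : r ^ 2 ∈ s
          · simp only [Set.indicator_of_mem ((hmem _).2 hrs)]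
            simp only [Set.indicator_of_mem hrs, smul_eq_mul, polarCoord_symm_apply,
              gaussianPDF_mul_gaussianPDF c hv]
            rw [lintegral_const_mul' _ _ ENNReal.ofReal_ne_top, hang r hr,
              ← ENNReal.ofReal_mul hr.le, ← ENNReal.ofReal_mul (abs_nonneg _),
              abs_of_pos (by positivity)]
            congr 1
            ring
          · simp only [Set.indicator_of_notMem (mt (hmem _).1 hrs), Set.indicator_of_notMem hrs,
              smul_zero, lintegral_zero, mul_zero]
        -- the substitution `t = r ^ 2`
        _ = ∫⁻ t in Set.Ioi (0 : ℝ), s.indicator (fun t => ENNReal.ofReal (sqDensity c v t)) t := by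
          have hcv := lintegral_image_eq_lintegral_abs_deriv_mul (s := Set.Ioi (0 : ℝ))
            (f := fun r => r ^ 2) (f' := fun r => 2 * r) measurableSet_Ioi
            (fun r _ => by simpa using (hasDerivAt_pow 2 r).hasDerivWithinAt)
            (fun a ha b hb hab => (pow_left_inj₀ (le_of_lt ha) (le_of_lt hb) two_ne_zero).1 hab)
            (s.indicator fun t => ENNReal.ofReal (sqDensity c v t))
          rw [himg] at hcv
          exact hcv.symm
        _ = _ := by
          rw [withDensity_apply _ hs, lintegral_indicator hs]
    · refine Measurable.aemeasurable ?_
      have h1 := continuous_polarCoord_symm.measurable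
      have h2 : Measurable (((fun q : ℝ × ℝ => q.1 ^ 2 + q.2 ^ 2) ⁻¹' s).indicator
          fun z : ℝ × ℝ => gaussianPDF c.re (v / 2).toNNReal z.1 *
            gaussianPDF c.im (v / 2).toNNReal z.2) :=
        Measurable.indicator (by fun_prop) hpre
      exact (measurable_fst.ennreal_ofReal).smul (h2.comp h1)

lemma measurable_complex_mk : Measurable fun q : ℝ × ℝ => (⟨q.1, q.2⟩ : ℂ) :=
  Complex.measurableEquivRealProd.symm.measurable

instance (ψ : ℝ) : IsProbabilityMeasure (complexGaussian ψ) :=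
  Measure.isProbabilityMeasure_map measurable_complex_mk.aemeasurable

lemma gaussianReal_map_affine (b s ψ : ℝ) (hψ : 0 ≤ ψ) :
    (gaussianReal 0 (ψ / 2).toNNReal).map (fun x => b + s * x) =
      gaussianReal b (s ^ 2 * ψ / 2).toNNReal := by
  have : (fun x : ℝ => b + s * x) = (fun x => b + x) ∘ (fun x => s * x) := rfl
  rw [this, ← Measure.map_map (by fun_prop) (by fun_prop), gaussianReal_map_const_mul,
    gaussianReal_map_const_add]
  congr 1
  · simp
  · ext
    rw [NNReal.coe_mul, Real.coe_toNNReal _ (by positivity), Real.coe_toNNReal _ (by positivity)]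
    simp [mul_div_assoc]

/-- Conditionally on the reference channel (`c`), the power gain of a port has this law: the squared
modulus of a complex Gaussian of mean `c` and variance `s ^ 2 * ψ`. -/
lemma hasBoundedDensity_norm_sq (c : ℂ) {s ψ : ℝ} (hs : 0 < s) (hψ : 0 < ψ) :
    HasBoundedDensity ((complexGaussian ψ).map fun w => ‖c + (s : ℂ) * w‖ ^ 2)
      (sqDensity c (s ^ 2 * ψ)) (s ^ 2 * ψ)⁻¹ := by
  convert hasBoundedDensity_sq_add_sq c (by positivity : 0 < s ^ 2 * ψ) using 1
  rw [← gaussianReal_map_affine c.re s ψ hψ.le, ← gaussianReal_map_affine c.im s ψ hψ.le,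
    Measure.map_prod_map _ _ (by fun_prop) (by fun_prop), complexGaussian,
    Measure.map_map (by fun_prop) measurable_complex_mk, Measure.map_map (by fun_prop)
    (by fun_prop)]
  congr 1
  ext q
  simp only [Function.comp_apply, Prod.map]
  rw [← Complex.normSq_eq_norm_sq, Complex.normSq_apply]
  simp
  ring

/-- The Laplace transform of `‖w‖ ^ 2`, which is exponentially distributed with mean `ψ`. -/
lemma integral_exp_neg_norm_sq {ψ k : ℝ} (hψ : 0 < ψ) (hk : 0 ≤ k) :
    ∫ w, Real.exp (-(k * ‖w‖ ^ 2)) ∂complexGaussian ψ = (1 + k * ψ)⁻¹ := by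
  have hv0 : (ψ / 2).toNNReal ≠ 0 := by simpa using hψ
  have h1 : ∫ x, Real.exp (-(k * x ^ 2)) ∂gaussianReal 0 (ψ / 2).toNNReal =
      √((1 + k * ψ)⁻¹) := by
    rw [integral_gaussianReal_eq_integral_smul hv0]
    have : ∀ x : ℝ, gaussianPDFReal 0 (ψ / 2).toNNReal x • Real.exp (-(k * x ^ 2)) =
        (√(Real.pi * ψ))⁻¹ * Real.exp (-(1 / ψ + k) * x ^ 2) := by
      intro x
      rw [gaussianPDFReal, Real.coe_toNNReal _ (by positivity), smul_eq_mul, mul_assoc,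
        ← Real.exp_add]
      congr 2
      · congr 1; ring
      · field_simp
        ring
    simp_rw [this]
    rw [integral_const_mul, integral_gaussian, ← Real.sqrt_inv, ← Real.sqrt_mul (by positivity)]
    congr 1
    have := Real.pi_pos.ne'
    field_simp
  have hn : ∀ q : ℝ × ℝ, Real.exp (-(k * ‖(⟨q.1, q.2⟩ : ℂ)‖ ^ 2)) =
      Real.exp (-(k * q.1 ^ 2)) * Real.exp (-(k * q.2 ^ 2)) := by
    intro q
    rw [← Real.exp_add, ← Complex.normSq_eq_norm_sq, Complex.normSq_apply]
    congr 1
    ring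
  rw [complexGaussian, integral_map measurable_complex_mk.aemeasurable
    (by fun_prop : Continuous fun w : ℂ => Real.exp (-(k * ‖w‖ ^ 2))).aestronglyMeasurable]
  simp_rw [hn]
  rw [integral_prod_mul (fun x => Real.exp (-(k * x ^ 2))) (fun x => Real.exp (-(k * x ^ 2))),
    h1, Real.mul_self_sqrt (by positivity)]

/-! ### Reduction to a mixture over the reference channels -/

/-- The inputs of the model, regrouped: from the pair of reference channels and the pairs of
innovations of the ports to the family indexed as in `IsRayleighInput`. -/
def regroup {M : ℕ} (q : (ℂ × ℂ) × (Fin M → ℂ × ℂ)) (j : Fin 2 × Option (Fin M)) : ℂ :=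
  j.2.elim (![q.1.1, q.1.2] j.1) fun m => ![(q.2 m).1, (q.2 m).2] j.1

lemma measurable_regroup {M : ℕ} : Measurable (regroup (M := M)) := by
  refine measurable_pi_lambda _ fun j => ?_
  obtain ⟨i, o⟩ := j
  fin_cases i <;> cases o <;> simp only [regroup, Option.elim] <;> simp <;> fun_prop

/-- Mutual independence of all inputs, read as independence of the pair of reference channels and
of the pairs belonging to the single ports. -/
lemma pi_eq_map_regroup {M : ℕ} (ξ : Fin 2 → Measure ℂ) [∀ i, IsProbabilityMeasure (ξ i)] :
    Measure.pi (fun j : Fin 2 × Option (Fin M) => ξ j.1) =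
      (((ξ 0).prod (ξ 1)).prod (Measure.pi fun _ : Fin M => (ξ 0).prod (ξ 1))).map regroup := by
  refine Measure.pi_eq fun s hs => ?_
  rw [Measure.map_apply measurable_regroup (MeasurableSet.univ_pi hs)]
  have hpre : regroup ⁻¹' (Set.univ.pi s) = (s (0, none) ×ˢ s (1, none)) ×ˢ
      Set.univ.pi fun m : Fin M => s (0, some m) ×ˢ s (1, some m) := by
    ext q
    simp only [Set.mem_preimage, Set.mem_pi, Set.mem_univ, forall_const, Prod.forall,
      Fin.forall_fin_two, Option.forall, Set.mem_prod, regroup, Option.elim]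
    simp only [Matrix.cons_val_zero, Matrix.cons_val_one]
    rw [forall_and]
    tauto
  rw [hpre, Measure.prod_prod, Measure.prod_prod, Measure.pi_pi]
  simp_rw [Measure.prod_prod]
  rw [Fintype.prod_prod_type, Fin.prod_univ_two, Fintype.prod_option, Fintype.prod_option,
    Finset.prod_mul_distrib]
  ring

/-- The outage event of one port, as a set of reference channels and innovations. -/
def portEvent (μ z : ℝ) : Set ((ℂ × ℂ) × ℂ × ℂ) :=
  {q | ‖(√μ : ℂ) * q.1.1 + (√(1 - μ) : ℂ) * q.2.1‖ ^ 2 *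
    ‖(√μ : ℂ) * q.1.2 + (√(1 - μ) : ℂ) * q.2.2‖ ^ 2 ≤ z}

/-- The outage probability of a single port, given the reference channels `c`. -/
noncomputable def portOutage (ψ : Fin 2 → ℝ) (μ z : ℝ) (c : ℂ × ℂ) : ℝ :=
  ((complexGaussian (ψ 0)).prod (complexGaussian (ψ 1))).real (Prod.mk c ⁻¹' portEvent μ z)

lemma measurableSet_portEvent (μ z : ℝ) : MeasurableSet (portEvent μ z) :=
  measurableSet_le (by fun_prop) (by fun_prop)

lemma measurable_portOutage (ψ : Fin 2 → ℝ) (μ z : ℝ) : Measurable (portOutage ψ μ z) :=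
  (measurable_measure_prodMk_left (ν := (complexGaussian (ψ 0)).prod (complexGaussian (ψ 1)))
    (measurableSet_portEvent μ z)).ennreal_toReal

/-- Given the reference channels, the ports are independent and identically distributed. -/
lemma measureReal_forall_le_eq_integral {Ω : Type*} [MeasurableSpace Ω] (P : Measure Ω)
    [IsProbabilityMeasure P] {M : ℕ} {ψ : Fin 2 → ℝ} (μ z : ℝ)
    {h₀ : Fin 2 → Ω → ℂ} {e : Fin 2 → Fin M → Ω → ℂ} (h : IsRayleighInput P ψ h₀ e) :
    P.real {ω | ∀ m, ‖channel μ h₀ e 0 m ω‖ ^ 2 * ‖channel μ h₀ e 1 m ω‖ ^ 2 ≤ z} =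
      ∫ c, portOutage ψ μ z c ^ M
        ∂(complexGaussian (ψ 0)).prod (complexGaussian (ψ 1)) := by
  set ξ : Measure (ℂ × ℂ) := (complexGaussian (ψ 0)).prod (complexGaussian (ψ 1)) with hξ
  set f : Fin 2 × Option (Fin M) → Ω → ℂ := fun j => j.2.elim (h₀ j.1) (e j.1) with hf
  have hlaw : ∀ j, HasLaw (f j) (complexGaussian (ψ j.1)) P := by
    rintro ⟨i, _ | m⟩
    exacts [h.law_ref i, h.law_port i m]
  have hfm : ∀ j, AEMeasurable (f j) P := fun j => (hlaw j).aemeasurable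
  set T : Set (Fin 2 × Option (Fin M) → ℂ) :=
    {x | ∀ m, ((x (0, none), x (1, none)), (x (0, some m), x (1, some m))) ∈ portEvent μ z} with hT
  have hTm : MeasurableSet T := by
    rw [hT, Set.ofPred_forall]
    exact MeasurableSet.iInter fun m =>
      (by fun_prop : Measurable fun x : Fin 2 × Option (Fin M) → ℂ =>
        ((x (0, none), x (1, none)), (x (0, some m), x (1, some m)))) (measurableSet_portEvent μ z)
  have hjoint : P.map (fun ω j => f j ω) =
      (ξ.prod (Measure.pi fun _ : Fin M => ξ)).map regroup := by
    rw [(iIndepFun_iff_map_fun_eq_pi_map hfm).1 h.indep, hξ,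
      ← pi_eq_map_regroup fun i => complexGaussian (ψ i)]
    congr 1
    ext1 j
    exact (hlaw j).map_eq
  have hmeas : P {ω | ∀ m, ‖channel μ h₀ e 0 m ω‖ ^ 2 * ‖channel μ h₀ e 1 m ω‖ ^ 2 ≤ z} =
      ∫⁻ c, ξ (Prod.mk c ⁻¹' portEvent μ z) ^ M ∂ξ := by
    have h1 : {ω | ∀ m, ‖channel μ h₀ e 0 m ω‖ ^ 2 * ‖channel μ h₀ e 1 m ω‖ ^ 2 ≤ z} =
        (fun ω j => f j ω) ⁻¹' T := rfl
    rw [h1, ← Measure.map_apply_of_aemeasurable (aemeasurable_pi_lambda _ hfm) hTm, hjoint,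
      Measure.map_apply measurable_regroup hTm, Measure.prod_apply (measurable_regroup hTm)]
    refine lintegral_congr fun c => ?_
    have h2 : Prod.mk c ⁻¹' (regroup ⁻¹' T) =
        Set.univ.pi fun _ : Fin M => Prod.mk c ⁻¹' portEvent μ z := by
      ext y
      simp [hT, regroup]
    rw [h2, Measure.pi_pi, Finset.prod_const, Finset.card_univ, Fintype.card_fin]
  rw [Measure.real, hmeas, ← integral_toReal]
  · simp_rw [ENNReal.toReal_pow]
    rfl
  · exact ((measurable_measure_prodMk_left (measurableSet_portEvent μ z)).pow_const M).aemeasurable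
  · exact ae_of_all _ fun c => ENNReal.pow_lt_top (measure_lt_top _ _)

/-! ### The outage probability as `z` tends to `0` -/

section Asymptotics

variable {ψ : Fin 2 → ℝ} {μ : ℝ}

/-- The bound on the density does not depend on the reference channel `a`, which is what dominated
convergence over the reference channels needs. -/
lemma hasBoundedDensity_gain (hμ1 : μ < 1) {p : ℝ} (hp : 0 < p) (a : ℂ) :
    HasBoundedDensity
      ((complexGaussian p).map fun w => ‖(√μ : ℂ) * a + (√(1 - μ) : ℂ) * w‖ ^ 2)
      (sqDensity ((√μ : ℂ) * a) ((1 - μ) * p)) ((1 - μ) * p)⁻¹ := by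
  have h := hasBoundedDensity_norm_sq ((√μ : ℂ) * a) (Real.sqrt_pos.2 (sub_pos.2 hμ1)) hp
  rwa [Real.sq_sqrt (sub_pos.2 hμ1).le] at h

lemma portOutage_eq (ψ : Fin 2 → ℝ) (μ z : ℝ) (c : ℂ × ℂ) :
    portOutage ψ μ z c =
      (((complexGaussian (ψ 0)).map fun w => ‖(√μ : ℂ) * c.1 + (√(1 - μ) : ℂ) * w‖ ^ 2).prod
        ((complexGaussian (ψ 1)).map fun w => ‖(√μ : ℂ) * c.2 + (√(1 - μ) : ℂ) * w‖ ^ 2)).real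
        {p | p.1 * p.2 ≤ z} := by
  rw [portOutage, Measure.map_prod_map _ _ (by fun_prop) (by fun_prop), Measure.real,
    Measure.real, Measure.map_apply (by fun_prop) (measurableSet_le (by fun_prop) (by fun_prop))]
  rfl

lemma sqDensity_gain_zero (hμ0 : 0 ≤ μ) (p : ℝ) (a : ℂ) :
    sqDensity ((√μ : ℂ) * a) ((1 - μ) * p) 0 =
      ((1 - μ) * p)⁻¹ * Real.exp (-(μ / ((1 - μ) * p) * ‖a‖ ^ 2)) := by
  rw [sqDensity_zero, norm_mul, mul_pow, Complex.norm_real,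
    Real.norm_of_nonneg (Real.sqrt_nonneg _), Real.sq_sqrt hμ0]
  congr 3
  ring

/-- The lower tail of the best port. Conditionally on the reference channels `(a, b)` every port
contributes `z * -log z` times the product of two densities at `0`, which are proportional to
`exp (-μ |a|² / ((1-μ) ψ₁))` and `exp (-μ |b|² / ((1-μ) ψ₂))`; averaging the `M`-th power of the
product gives `chiParam`. -/
lemma tendsto_integral_portOutage_div (M : ℕ) (hψ : ∀ i, 0 < ψ i) (hμ0 : 0 ≤ μ) (hμ1 : μ < 1) :
    Tendsto (fun z => (∫ c, portOutage ψ μ z c ^ M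
        ∂(complexGaussian (ψ 0)).prod (complexGaussian (ψ 1))) / (z * -Real.log z) ^ M)
      (𝓝[>] 0) (𝓝 (chiParam M μ * ((ψ 0 * ψ 1 * (1 - μ) ^ 2)⁻¹) ^ M)) := by
  have hm : 0 < 1 - μ := sub_pos.2 hμ1
  have h0 := hψ 0
  have h1 := hψ 1
  -- the bound of `measureReal_mul_le_le`, uniform in the reference channels
  set k : ℝ := ((1 - μ) * ψ 0)⁻¹ * ((1 - μ) * ψ 1)⁻¹ + ((1 - μ) * ψ 0)⁻¹ + ((1 - μ) * ψ 1)⁻¹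
    with hk
  have hprob : ∀ (p : ℝ) (a : ℂ), IsProbabilityMeasure
      ((complexGaussian p).map fun w => ‖(√μ : ℂ) * a + (√(1 - μ) : ℂ) * w‖ ^ 2) :=
    fun p a => Measure.isProbabilityMeasure_map (by fun_prop)
  have hlim : Tendsto (fun z => ∫ c, (portOutage ψ μ z c / (z * -Real.log z)) ^ M
      ∂(complexGaussian (ψ 0)).prod (complexGaussian (ψ 1))) (𝓝[>] 0)
      (𝓝 (∫ c : ℂ × ℂ, (sqDensity ((√μ : ℂ) * c.1) ((1 - μ) * ψ 0) 0 *
        sqDensity ((√μ : ℂ) * c.2) ((1 - μ) * ψ 1) 0) ^ M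
        ∂(complexGaussian (ψ 0)).prod (complexGaussian (ψ 1)))) := by
    refine tendsto_integral_filter_of_dominated_convergence (fun _ => k ^ M) ?_ ?_
      (integrable_const _) ?_
    · exact Eventually.of_forall fun z =>
        (((measurable_portOutage ψ μ z).div_const _).pow_const M).aestronglyMeasurable
    · filter_upwards [Ioo_mem_nhdsGT (Real.exp_pos (-1))] with z hz
      refine ae_of_all _ fun c => ?_
      have hL : 0 < -Real.log z :=
        neg_pos.2 (Real.log_neg hz.1 (hz.2.trans (by simp)))
      have hnn : 0 ≤ portOutage ψ μ z c / (z * -Real.log z) :=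
        div_nonneg measureReal_nonneg (mul_pos hz.1 hL).le
      rw [Real.norm_of_nonneg (pow_nonneg hnn M)]
      refine pow_le_pow_left₀ hnn ?_ M
      rw [portOutage_eq]
      exact measureReal_mul_le_le (hasBoundedDensity_gain hμ1 h0 c.1)
        (hasBoundedDensity_gain hμ1 h1 c.2) hz.1 hz.2
    · refine ae_of_all _ fun c => ?_
      simp_rw [portOutage_eq]
      exact (tendsto_measureReal_mul_le_div (hasBoundedDensity_gain hμ1 h0 c.1)
        (hasBoundedDensity_gain hμ1 h1 c.2)).pow M
  have hval : ∫ c : ℂ × ℂ, (sqDensity ((√μ : ℂ) * c.1) ((1 - μ) * ψ 0) 0 *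
      sqDensity ((√μ : ℂ) * c.2) ((1 - μ) * ψ 1) 0) ^ M
      ∂(complexGaussian (ψ 0)).prod (complexGaussian (ψ 1)) =
      chiParam M μ * ((ψ 0 * ψ 1 * (1 - μ) ^ 2)⁻¹) ^ M := by
    have hpt : ∀ c : ℂ × ℂ, (sqDensity ((√μ : ℂ) * c.1) ((1 - μ) * ψ 0) 0 *
        sqDensity ((√μ : ℂ) * c.2) ((1 - μ) * ψ 1) 0) ^ M =
        ((ψ 0 * ψ 1 * (1 - μ) ^ 2)⁻¹) ^ M *
          (Real.exp (-(M * (μ / ((1 - μ) * ψ 0)) * ‖c.1‖ ^ 2)) *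
            Real.exp (-(M * (μ / ((1 - μ) * ψ 1)) * ‖c.2‖ ^ 2))) := by
      intro c
      have hexp : ∀ x : ℝ, Real.exp (-(M * x)) = Real.exp (-x) ^ M := fun x => by
        rw [← mul_neg, Real.exp_nat_mul]
      rw [sqDensity_gain_zero hμ0, sqDensity_gain_zero hμ0, mul_assoc (M : ℝ), mul_assoc (M : ℝ),
        hexp, hexp, ← mul_pow, ← mul_pow]
      have hκ : ((1 - μ) * ψ 0)⁻¹ * ((1 - μ) * ψ 1)⁻¹ = (ψ 0 * ψ 1 * (1 - μ) ^ 2)⁻¹ := by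
        rw [← mul_inv]
        congr 1
        ring
      rw [← hκ]
      ring
    simp_rw [hpt]
    rw [integral_const_mul, integral_prod_mul
      (fun a : ℂ => Real.exp (-(M * (μ / ((1 - μ) * ψ 0)) * ‖a‖ ^ 2)))
      (fun b : ℂ => Real.exp (-(M * (μ / ((1 - μ) * ψ 1)) * ‖b‖ ^ 2))),
      integral_exp_neg_norm_sq h0 (by positivity), integral_exp_neg_norm_sq h1 (by positivity),
      chiParam, mul_comm]
    congr 1
    have hd : (M : ℝ) * μ + 1 - μ ≠ 0 := by
      have : 0 ≤ (M : ℝ) * μ := by positivity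
      linarith
    have hfac : ∀ i, (1 + (M : ℝ) * (μ / ((1 - μ) * ψ i)) * ψ i)⁻¹ =
        (1 - μ) / (M * μ + 1 - μ) := by
      intro i
      have hi := (hψ i).ne'
      have : 1 + (M : ℝ) * (μ / ((1 - μ) * ψ i)) * ψ i = (M * μ + 1 - μ) / (1 - μ) := by
        field_simp
        ring
      rw [this, inv_div]
    rw [hfac, hfac, sq]
  rw [hval] at hlim
  refine hlim.congr fun z => ?_
  simp_rw [div_pow]
  rw [integral_div]

lemma chiParam_pos (M : ℕ) (hμ0 : 0 ≤ μ) (hμ1 : μ < 1) : 0 < chiParam M μ := by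
  have hm : 0 < 1 - μ := sub_pos.2 hμ1
  have : 0 ≤ (M : ℝ) * μ := by positivity
  exact pow_pos (div_pos hm (by linarith)) 2

lemma isEquivalent_log_const_mul {κ : ℝ} (hκ : 0 < κ) :
    (fun z => Real.log (κ * z)) ~[𝓝[>] 0] Real.log := by
  have h : (fun _ : ℝ => Real.log κ) =o[𝓝[>] 0] Real.log :=
    isLittleO_const_left.2 <| Or.inr <|
      tendsto_abs_atBot_atTop.comp Real.tendsto_log_nhdsGT_zero
  refine (IsEquivalent.refl.add_isLittleO h).congr_left ?_
  filter_upwards [self_mem_nhdsWithin] with z hz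
  have hz : 0 < z := hz
  rw [Pi.add_apply, Real.log_mul hκ.ne' hz.ne', add_comm]

/-- If `F z` is asymptotic to `C (-z log z) ^ M`, the argument of the logarithm may be rescaled. -/
lemma isEquivalent_of_tendsto_div {F : ℝ → ℝ} {χ κ : ℝ} {M : ℕ} (hχ : 0 < χ) (hκ : 0 < κ)
    (hF : Tendsto (fun z => F z / (z * -Real.log z) ^ M) (𝓝[>] 0) (𝓝 (χ * κ ^ M))) :
    F ~[𝓝[>] 0] fun z => χ * (-(κ * z * Real.log (κ * z))) ^ M := by
  have hev : ∀ᶠ z : ℝ in 𝓝[>] 0, z ∈ Set.Ioo (0 : ℝ) 1 := Ioo_mem_nhdsGT one_pos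
  have h1 : F ~[𝓝[>] 0] fun z => χ * (κ * z * -Real.log z) ^ M := by
    have hc : (fun z => F z / (z * -Real.log z) ^ M) ~[𝓝[>] 0] fun _ => χ * κ ^ M :=
      (isEquivalent_const_iff_tendsto (by positivity)).2 hF
    refine ((hc.mul (IsEquivalent.refl (u := fun z : ℝ => (z * -Real.log z) ^ M))).congr_left
      ?_).congr_right ?_
    · filter_upwards [hev] with z hz
      have hL : 0 < -Real.log z := neg_pos.2 (Real.log_neg hz.1 hz.2)
      exact div_mul_cancel₀ _ (pow_pos (mul_pos hz.1 hL) M).ne'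
    · refine Eventually.of_forall fun z => ?_
      simp only [Pi.mul_apply, mul_pow]
      ring
  -- `log (κ z)` is asymptotic to `log z`
  refine h1.trans ?_
  refine IsEquivalent.mul IsEquivalent.refl (IsEquivalent.pow ?_ M)
  have h2 : (fun z : ℝ => κ * z * -Real.log z) ~[𝓝[>] 0]
      fun z => κ * z * -Real.log (κ * z) :=
    IsEquivalent.mul IsEquivalent.refl (isEquivalent_log_const_mul hκ).symm.neg
  simpa only [mul_neg] using h2

/-- The exponent of `z` in `C (-z log z) ^ M` is `M`: the logarithmic factor is negligible on the
logarithmic scale. -/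
lemma tendsto_log_div_log {F : ℝ → ℝ} {C : ℝ} {M : ℕ} (hC : 0 < C)
    (hF : Tendsto (fun z => F z / (z * -Real.log z) ^ M) (𝓝[>] 0) (𝓝 C)) :
    Tendsto (fun z => Real.log (F z) / Real.log z) (𝓝[>] 0) (𝓝 M) := by
  have hev : ∀ᶠ z : ℝ in 𝓝[>] 0, z ∈ Set.Ioo (0 : ℝ) 1 := Ioo_mem_nhdsGT one_pos
  have hL := tendsto_neg_log_nhdsGT_zero
  have a : Tendsto (fun z => Real.log (F z / (z * -Real.log z) ^ M) / -Real.log z) (𝓝[>] 0)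
      (𝓝 0) := (hF.log hC.ne').div_atTop hL
  have b : Tendsto (fun z => Real.log (-Real.log z) / -Real.log z) (𝓝[>] 0) (𝓝 0) :=
    (Real.isLittleO_log_id_atTop.tendsto_div_nhds_zero).comp hL
  have c := (tendsto_const_nhds (x := (M : ℝ))).sub (a.add (b.const_mul (M : ℝ)))
  simp only [mul_zero, add_zero, sub_zero] at c
  refine c.congr' ?_
  filter_upwards [hev, hF.eventually_const_lt hC] with z hz hpos
  have hl : 0 < -Real.log z := neg_pos.2 (Real.log_neg hz.1 hz.2)
  have hp : 0 < (z * -Real.log z) ^ M := pow_pos (mul_pos hz.1 hl) M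
  have hFz : F z ≠ 0 := fun h => by simp [h] at hpos
  rw [Real.log_div hFz hp.ne', Real.log_pow, Real.log_mul hz.1.ne' hl.ne']
  have := neg_ne_zero.1 hl.ne'
  field_simp
  ring

lemma snrThreshold_pos {R : ℝ} (hR : 0 < R) : 0 < snrThreshold R :=
  sub_pos.2 (Real.one_lt_rpow one_lt_two hR)

lemma zParam_pos {PS ρ θ σ2 R : ℝ} (hPS : 0 < PS) (hρ : 0 < ρ) (hθ : 0 < θ) (hσ : 0 < σ2)
    (hR : 0 < R) : 0 < zParam PS ρ θ σ2 R :=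
  div_pos (mul_pos (snrThreshold_pos hR) hσ) (by positivity)

lemma betaParam_eq (ψ : Fin 2 → ℝ) (μ PS ρ θ σ2 R : ℝ) :
    betaParam ψ μ PS ρ θ σ2 R = (ψ 0 * ψ 1 * (1 - μ) ^ 2)⁻¹ * zParam PS ρ θ σ2 R := by
  rw [betaParam, zParam, div_eq_mul_inv, div_eq_mul_inv]
  simp only [mul_inv]
  ring

/-- With at least one port the supremum in `bestPortSNR` is a genuine maximum. -/
lemma outageProb_eq {Ω : Type*} [MeasurableSpace Ω] (P : Measure Ω) {M : ℕ} (hM : 1 ≤ M)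
    (h : Fin 2 → Fin M → Ω → ℂ) {PS ρ θ σ2 : ℝ} (R : ℝ) (hPS : 0 < PS) (hρ : 0 < ρ) (hθ : 0 < θ)
    (hσ : 0 < σ2) :
    outageProb P h PS ρ θ σ2 R =
      P.real {ω | ∀ m, ‖h 0 m ω‖ ^ 2 * ‖h 1 m ω‖ ^ 2 ≤ zParam PS ρ θ σ2 R} := by
  have : Nonempty (Fin M) := ⟨⟨0, hM⟩⟩
  rw [outageProb]
  congr 1
  ext ω
  simp only [Set.mem_ofPred_eq, bestPortSNR]
  rw [ciSup_le_iff (Set.finite_range _).bddAbove]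
  refine forall_congr' fun m => ?_
  rw [portSNR, zParam, le_div_iff₀ (by positivity), div_mul_eq_mul_div, div_le_iff₀ hσ, mul_comm]

end Asymptotics

end FAS

theorem theorem1 {Ω : Type*} [MeasurableSpace Ω] (P : Measure Ω) [IsProbabilityMeasure P]
    (M : ℕ) (hM : 1 ≤ M) (ψ : Fin 2 → ℝ) (hψ : ∀ i, 0 < ψ i)
    (μ : ℝ) (hμ0 : 0 ≤ μ) (hμ1 : μ < 1)
    (h₀ : Fin 2 → Ω → ℂ) (e : Fin 2 → Fin M → Ω → ℂ)
    (hchan : FAS.IsRayleighInput P ψ h₀ e) :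
    -- the asymptotic outage probability, in every regime in which `z` tends to `0`
    (∀ {ι : Type*} (l : Filter ι) (PS ρ θ σ2 R : ι → ℝ),
      (∀ᶠ t in l, 0 < PS t ∧ 0 < ρ t ∧ 0 < θ t ∧ 0 < σ2 t ∧ 0 < R t) →
      Tendsto (fun t => FAS.zParam (PS t) (ρ t) (θ t) (σ2 t) (R t)) l (𝓝 0) →
      (fun t => FAS.outageProb P (FAS.channel μ h₀ e) (PS t) (ρ t) (θ t) (σ2 t) (R t)) ~[l]
        (fun t => FAS.chiParam M μ *
          (-(FAS.betaParam ψ μ (PS t) (ρ t) (θ t) (σ2 t) (R t) *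
            Real.log (FAS.betaParam ψ μ (PS t) (ρ t) (θ t) (σ2 t) (R t)))) ^ M)) ∧
    -- the diversity order is `M`, as the transmit SNR tends to infinity
    (∀ {ι : Type*} (l : Filter ι) (PS σ2 : ι → ℝ) (ρ θ R : ℝ), 0 < ρ → 0 < θ → 0 < R →
      (∀ᶠ t in l, 0 < PS t ∧ 0 < σ2 t) →
      Tendsto (fun t => PS t / σ2 t) l atTop →
      Tendsto (fun t => -Real.log (FAS.outageProb P (FAS.channel μ h₀ e) (PS t) ρ θ (σ2 t) R) /
        Real.log (PS t / σ2 t)) l (𝓝 (M : ℝ))) := by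
  have hκ : 0 < (ψ 0 * ψ 1 * (1 - μ) ^ 2)⁻¹ :=
    inv_pos.2 (mul_pos (mul_pos (hψ 0) (hψ 1)) (pow_pos (sub_pos.2 hμ1) 2))
  have hχ := FAS.chiParam_pos M hμ0 hμ1
  have hF := FAS.tendsto_integral_portOutage_div M hψ hμ0 hμ1
  refine ⟨fun l PS ρ θ σ2 R hpos hz => ?_, fun l PS σ2 ρ θ R hρ hθ hR hpos hsnr => ?_⟩
  · have hz' : Tendsto (fun t => FAS.zParam (PS t) (ρ t) (θ t) (σ2 t) (R t)) l (𝓝[>] 0) :=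
      tendsto_nhdsWithin_iff.2 ⟨hz, hpos.mono fun t ⟨h1, h2, h3, h4, h5⟩ =>
        FAS.zParam_pos h1 h2 h3 h4 h5⟩
    refine ((FAS.isEquivalent_of_tendsto_div hχ hκ hF).comp_tendsto hz').congr_left ?_
      |>.congr_right ?_
    · filter_upwards [hpos] with t ⟨h1, h2, h3, h4, h5⟩
      rw [FAS.outageProb_eq P hM _ _ h1 h2 h3 h4,
        FAS.measureReal_forall_le_eq_integral P μ _ hchan]
      rfl
    · exact Eventually.of_forall fun t => by simp only [Function.comp_apply, FAS.betaParam_eq]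
  · set c : ℝ := FAS.snrThreshold R / (ρ * θ) with hc
    have hc0 : 0 < c := div_pos (FAS.snrThreshold_pos hR) (mul_pos hρ hθ)
    have hzeq : ∀ t, FAS.zParam (PS t) ρ θ (σ2 t) R = c * (PS t / σ2 t)⁻¹ := by
      intro t
      rw [hc, FAS.zParam, inv_div, div_mul_div_comm]
      congr 1
      ring
    have hz : Tendsto (fun t => FAS.zParam (PS t) ρ θ (σ2 t) R) l (𝓝[>] 0) := by
      refine tendsto_nhdsWithin_iff.2 ⟨?_, hpos.mono fun t ⟨h1, h2⟩ =>
        FAS.zParam_pos h1 hρ hθ h2 hR⟩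
      simp_rw [hzeq]
      simpa using (tendsto_inv_atTop_zero.comp hsnr).const_mul c
    -- `log z` and `-log (PS / σ2)` differ by the constant `log c`
    have h1 := (FAS.tendsto_log_div_log (mul_pos hχ (pow_pos hκ M)) hF).comp hz
    have h2 : Tendsto (fun t => 1 - Real.log c / Real.log (PS t / σ2 t)) l (𝓝 1) := by
      simpa using (tendsto_const_nhds (x := (1 : ℝ))).sub
        ((Real.tendsto_log_atTop.comp hsnr).const_div_atTop (Real.log c))
    have h3 := h1.mul h2
    rw [mul_one] at h3
    refine h3.congr' ?_
    filter_upwards [hpos, hsnr.eventually_gt_atTop 1,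
      (tendsto_nhdsWithin_iff.1 hz).1.eventually_lt_const one_pos] with t ⟨h4, h5⟩ h6 h7
    rw [FAS.outageProb_eq P hM _ _ h4 hρ hθ h5,
      FAS.measureReal_forall_le_eq_integral P μ _ hchan]
    have hlz : Real.log (FAS.zParam (PS t) ρ θ (σ2 t) R) =
        Real.log c - Real.log (PS t / σ2 t) := by
      rw [hzeq, Real.log_mul hc0.ne' (inv_pos.2 (one_pos.trans h6)).ne', Real.log_inv,
        sub_eq_add_neg]
    have hls : Real.log (PS t / σ2 t) ≠ 0 := (Real.log_pos h6).ne'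
    have hlz0 : Real.log (FAS.zParam (PS t) ρ θ (σ2 t) R) ≠ 0 :=
      (Real.log_neg (FAS.zParam_pos h4 hρ hθ h5 hR) h7).ne
    have h8 : 1 - Real.log c / Real.log (PS t / σ2 t) =
        -(Real.log (FAS.zParam (PS t) ρ θ (σ2 t) R) / Real.log (PS t / σ2 t)) := by
      rw [hlz]
      field_simp
      ring
    simp only [Function.comp_apply]
    rw [h8]
    field_simp
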